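/- For $n\ge 1$ let $s(n)$ be the number of subgroups of the group $\mathbb{Z}_n\times\mathbb{Z}_n\times\mathbb{Z}_n$, let $\tau(n)$ be the number of positive divisors of $n$, and let $\gamma$ be the Euler–Mascheroni constant. Let $h$ be the arithmetic function defined by $$s(n)=\sum_{d\mid n} d^2\,\tau(d)\,h(n/d)\qquad(n\ge 1),$$ and let $H(z)=\sum_{n=1}^{\infty}h(n)n^{-z}$ be its Dirichlet series. Let $\theta$ be any real number such that $$\sum_{n\le x}\tau(n)=x\log x+(2\gamma-1)x+O(x^{\theta+\varepsilon})\qquad\text{for every }\varepsilon>0 .$$ Then the abscissa of absolute convergence of $H$ is less than $3$ (so that $H(3)$ and $H'(3)$ are well defined), and for every $\varepsilon>0$, $$\sum_{n\le x}s(n)=\frac{x^3}{3}\left(H(3)\left(\log x+2\gamma-\tfrac13\right)+H'(3)\right)+O(x^{2+\theta+\varepsilon}),$$ where $H'$ is the derivative of $H$. -/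

import Mathlib

namespace RankThree

/-- The number of subgroups of the group `ℤ_m × ℤ_n × ℤ_r`. -/
noncomputable def s₃ (m n r : ℕ) : ℕ := Nat.card (AddSubgroup (ZMod m × ZMod n × ZMod r))

/-- `s(n) = s(n, n, n)`, the number of subgroups of `ℤ_n × ℤ_n × ℤ_n`. -/
noncomputable def s (n : ℕ) : ℕ := s₃ n n n

/-- `τ(n)`, the number of positive divisors of `n`. -/
def tau (n : ℕ) : ℕ := n.divisors.card

/-- The arithmetic function `h` determined by `s(n) = ∑_{d ∣ n} d² τ(d) h(n/d)` for `n ≥ 1`: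
the term `d = 1` of that sum is `h(n)`, so the equation is solved recursively for `h(n)`.
See `s_eq_sum` for the defining equation and `eq_h_of_s_eq_sum` for uniqueness. -/
noncomputable def h (n : ℕ) : ℤ :=
  (s n : ℤ) - ∑ e ∈ n.properDivisors.attach,
    ((n / e.1 : ℕ) : ℤ) ^ 2 * (tau (n / e.1) : ℤ) * h e.1
termination_by n
decreasing_by exact (Nat.mem_properDivisors.mp e.2).2

theorem sum_split (f : ℕ → ℤ) {n : ℕ} (hn : 1 ≤ n) :
    ∑ d ∈ n.divisors, (d : ℤ) ^ 2 * (tau d : ℤ) * f (n / d)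
      = f n + ∑ e ∈ n.properDivisors, ((n / e : ℕ) : ℤ) ^ 2 * (tau (n / e) : ℤ) * f e := by
  have h1 := Nat.sum_div_divisors n
    (fun d => (d : ℤ) ^ 2 * (tau d : ℤ) * f (n / d))
  rw [← h1, ← Nat.insert_self_properDivisors (by omega), Finset.sum_insert (by simp)]
  congr 1
  · simp [Nat.div_self (show 0 < n by omega), tau]
  · refine Finset.sum_congr rfl fun e he => ?_
    rw [Nat.div_div_self (Nat.mem_properDivisors.mp he).1 (by omega)]

/-- The defining equation of `h`. -/
theorem s_eq_sum {n : ℕ} (hn : 1 ≤ n) :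
    (s n : ℤ) = ∑ d ∈ n.divisors, (d : ℤ) ^ 2 * (tau d : ℤ) * h (n / d) := by
  rw [sum_split h hn, h, Finset.sum_attach n.properDivisors
    (fun e => ((n / e : ℕ) : ℤ) ^ 2 * (tau (n / e) : ℤ) * h e)]
  ring

/-- The defining equation determines `h` on the positive integers. -/
theorem eq_h_of_s_eq_sum (g : ℕ → ℤ)
    (hg : ∀ n : ℕ, 1 ≤ n →
      (s n : ℤ) = ∑ d ∈ n.divisors, (d : ℤ) ^ 2 * (tau d : ℤ) * g (n / d)) :
    ∀ n : ℕ, 1 ≤ n → g n = h n := by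
  intro n
  induction n using Nat.strong_induction_on with
  | _ n ih =>
    intro hn
    have h1 := hg n hn
    have h2 := s_eq_sum hn
    rw [sum_split g hn] at h1
    rw [sum_split h hn] at h2
    have h3 : ∑ e ∈ n.properDivisors, ((n / e : ℕ) : ℤ) ^ 2 * (tau (n / e) : ℤ) * g e
        = ∑ e ∈ n.properDivisors, ((n / e : ℕ) : ℤ) ^ 2 * (tau (n / e) : ℤ) * h e := by
      refine Finset.sum_congr rfl fun e he => ?_
      rw [ih e (Nat.mem_properDivisors.mp he).2 (Nat.pos_of_mem_properDivisors he)]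
    linarith

/-- The Dirichlet series `H(z) = ∑_{n ≥ 1} h(n) n^{-z}`. -/
noncomputable def H (z : ℂ) : ℂ := LSeries (fun n => (h n : ℂ)) z

end RankThree

/-!
The Dirichlet series of `s` is `ζ(z - 2)² H(z)`, so `∑_{n ≤ x} s(n) = ∑_m h(m) D(x / m)` with
`D(y) = ∑_{d ≤ y} d² τ(d)`. By partial summation (`exists_sumSqTau_error_le`) the hypothesis gives
`D(y) = y³/3 (log y + 2γ - 1/3) + O(y^{2 + η})` with `η = θ + ε`. Summed against `h`, the main term
produces `H(3)` and `H'(3)` exactly, the sum being extended over all `m`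
(`hasSum_h_mul_sqTauMain`). The error is `O(x^{2 + η})` as soon as `∑ |h(m)| m^{-(2 + η)}`
converges. The exponent `η` is positive, because the error in the divisor problem is unbounded
(`pos_of_isBigO_divisor`), so what remains is the absolute convergence of `H(z)` for `Re z > 2`
(`summable_abs_h_mul_rpow`).

Subgroups of groups of coprime orders multiply, so `s` and `h` are multiplicative, and by an Euler
product it is enough to show `|h(p^k)| ≤ 4 (k + 1)³ p^{2k - 1}` for `k ≥ 1`
(`abs_hFun_prime_pow_le`). Since `h(p^k) = s(p^k) - 2 p² s(p^{k-1}) + p⁴ s(p^{k-2})`, this follows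
from `s(p^k) = (k + 1) p^{2k} + O((k + 1)³ p^{2k - 1})`, where the main term cancels.

This estimate (`le_s`, `s_le`) comes from Goursat's lemma: a subgroup of `A × B` is a triple made of
its section `K ≤ B`, its projection `C ≤ A` and a homomorphism `C → B ⧸ K`. Applied to
`ℤ_n × ℤ_n²` and then to `ℤ_n × ℤ_n`, it writes `s(n)` as a sum over triples of subgroups of `ℤ_n`,
of which there are `τ(n)³`. The triples with the first projection full and the last section trivial
contribute `n²` each, `n² τ(n)` in all. Every other triple contributes at most `n m`, where `m` is
the largest proper divisor of `n`, because homomorphisms between cyclic groups are at most as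
many as the elements of the source.
-/

/-! ### Subgroups of a product of two abelian groups -/

namespace RankThree

section Goursat

variable {A B : Type*} [AddCommGroup A] [AddCommGroup B]

/-- The subgroup `{(a, b) | a ∈ C, φ a = b mod K}` of `A × B`, the graph of `φ : C → B ⧸ K`. -/
def graphOf (K : AddSubgroup B) (C : AddSubgroup A) (φ : C →+ B ⧸ K) : AddSubgroup (A × B) where
  carrier := {x | ∃ hx : x.1 ∈ C, φ ⟨x.1, hx⟩ = (x.2 : B ⧸ K)}
  zero_mem' := ⟨C.zero_mem, φ.map_zero⟩
  add_mem' := by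
    rintro x y ⟨hx, hx'⟩ ⟨hy, hy'⟩
    refine ⟨C.add_mem hx hy, ?_⟩
    have := φ.map_add ⟨x.1, hx⟩ ⟨y.1, hy⟩
    rw [hx', hy'] at this
    exact this
  neg_mem' := by
    rintro x ⟨hx, hx'⟩
    refine ⟨C.neg_mem hx, ?_⟩
    have := φ.map_neg ⟨x.1, hx⟩
    rw [hx'] at this
    exact this

theorem comap_inr_graphOf (K : AddSubgroup B) (C : AddSubgroup A) (φ : C →+ B ⧸ K) :
    (graphOf K C φ).comap (AddMonoidHom.inr A B) = K := by
  ext b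
  constructor
  · rintro ⟨h0, hb⟩
    have h1 : φ ⟨0, h0⟩ = 0 := φ.map_zero
    exact (QuotientAddGroup.eq_zero_iff b).1 (hb.symm.trans h1)
  · intro hb
    exact ⟨C.zero_mem, φ.map_zero.trans ((QuotientAddGroup.eq_zero_iff b).2 hb).symm⟩

theorem map_fst_graphOf (K : AddSubgroup B) (C : AddSubgroup A) (φ : C →+ B ⧸ K) :
    (graphOf K C φ).map (AddMonoidHom.fst A B) = C := by
  ext a
  constructor
  · rintro ⟨x, ⟨hx, -⟩, rfl⟩
    exact hx
  · intro ha
    obtain ⟨b, hb⟩ := QuotientAddGroup.mk_surjective (φ ⟨a, ha⟩)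
    exact ⟨(a, b), ⟨ha, hb.symm⟩, rfl⟩

theorem graphOf_injective (K : AddSubgroup B) (C : AddSubgroup A) :
    Function.Injective (graphOf K C) := by
  intro φ ψ h
  ext ⟨a, ha⟩
  obtain ⟨b, hb⟩ := QuotientAddGroup.mk_surjective (φ ⟨a, ha⟩)
  have h1 : (a, b) ∈ graphOf K C φ := ⟨ha, hb.symm⟩
  rw [h] at h1
  obtain ⟨_, h2⟩ := h1
  rw [← hb]
  exact h2.symm

theorem exists_graphOf_eq (H : AddSubgroup (A × B)) :
    ∃ φ, graphOf (H.comap (AddMonoidHom.inr A B)) (H.map (AddMonoidHom.fst A B)) φ = H := by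
  have hex : ∀ a : H.map (AddMonoidHom.fst A B), ∃ b, ((a : A), b) ∈ H := by
    rintro ⟨_, ⟨x, hx, rfl⟩⟩
    exact ⟨x.2, hx⟩
  choose f hf using hex
  have key : ∀ (a : A) (b b' : B), (a, b) ∈ H → (a, b') ∈ H →
      (b : B ⧸ H.comap (AddMonoidHom.inr A B)) = b' := by
    intro a b b' hb hb'
    rw [QuotientAddGroup.eq]
    have := H.add_mem (H.neg_mem hb) hb'
    simpa using this
  refine ⟨AddMonoidHom.mk' (fun a => (f a : B ⧸ H.comap (AddMonoidHom.inr A B))) ?_, ?_⟩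
  · intro a b
    refine key _ _ _ (hf (a + b)) ?_
    simpa using H.add_mem (hf a) (hf b)
  · ext ⟨a, b⟩
    constructor
    · rintro ⟨ha, hb⟩
      have h1 := hf ⟨a, ha⟩
      have h2 : -f ⟨a, ha⟩ + b ∈ H.comap (AddMonoidHom.inr A B) := QuotientAddGroup.eq.1 hb
      have h3 := H.add_mem h1 h2
      simpa using h3
    · intro hab
      have ha : a ∈ H.map (AddMonoidHom.fst A B) := ⟨(a, b), hab, rfl⟩
      exact ⟨ha, key _ _ _ (hf ⟨a, ha⟩) hab⟩

/-- Goursat's lemma in counting form: a subgroup `H` of `A × B` amounts to its section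
`K = {b | (0, b) ∈ H}`, its projection `C` to `A`, and a homomorphism `C → B ⧸ K`. -/
theorem card_goursat_fiber (K : AddSubgroup B) (C : AddSubgroup A) :
    Nat.card {H : AddSubgroup (A × B) //
      H.comap (AddMonoidHom.inr A B) = K ∧ H.map (AddMonoidHom.fst A B) = C} =
    Nat.card (C →+ B ⧸ K) := by
  symm
  refine Nat.card_eq_of_bijective
    (fun φ => ⟨graphOf K C φ, comap_inr_graphOf K C φ, map_fst_graphOf K C φ⟩) ⟨?_, ?_⟩
  · intro φ ψ h
    exact graphOf_injective K C (Subtype.ext_iff.1 h)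
  · rintro ⟨H, rfl, rfl⟩
    obtain ⟨φ, hφ⟩ := exists_graphOf_eq H
    exact ⟨φ, Subtype.ext hφ⟩

/-- A sum over the subgroups of `A × B` of a function of the section `K` and the projection `C` only,
grouped by `(C, K)`. -/
theorem sum_subgroups_prod [Fintype (AddSubgroup A)] [Fintype (AddSubgroup B)]
    [Fintype (AddSubgroup (A × B))] (g : AddSubgroup B → AddSubgroup A → ℕ) :
    ∑ H : AddSubgroup (A × B), g (H.comap (AddMonoidHom.inr A B)) (H.map (AddMonoidHom.fst A B)) =
      ∑ C : AddSubgroup A, ∑ K : AddSubgroup B, Nat.card (C →+ B ⧸ K) * g K C := by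
  classical
  rw [← Fintype.sum_prod_type' (f := fun (C : AddSubgroup A) (K : AddSubgroup B) =>
    Nat.card (C →+ B ⧸ K) * g K C)]
  rw [← Finset.sum_fiberwise (s := (Finset.univ : Finset (AddSubgroup (A × B))))
    (g := fun H => (H.map (AddMonoidHom.fst A B), H.comap (AddMonoidHom.inr A B)))]
  refine Finset.sum_congr rfl fun x _ => ?_
  obtain ⟨C, K⟩ := x
  rw [← card_goursat_fiber K C, Nat.card_eq_fintype_card, Fintype.card_subtype, ← smul_eq_mul,
    ← Finset.sum_const]
  refine (Finset.sum_congr ?_ fun H hH => ?_)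
  · ext H; simp [and_comm]
  · simp only [Finset.mem_filter] at hH
    rw [hH.2.1, hH.2.2]

end Goursat

section Cyclic

/-- Homomorphisms from a finite cyclic group of order `e` to `Q` are counted by the elements of
`Q` killed by `e`. -/
theorem card_hom_of_isAddCyclic (C : Type*) [AddCommGroup C] [IsAddCyclic C] (Q : Type*)
    [AddCommGroup Q] :
    Nat.card (C →+ Q) = Nat.card (nsmulAddMonoidHom (Nat.card C) : Q →+ Q).ker := by
  let e : ZMod (Nat.card C) ≃+ C := zmodAddCyclicAddEquiv inferInstance
  have e1 : (C →+ Q) ≃ (ZMod (Nat.card C) →+ Q) := e.symm.addMonoidHomCongrLeftEquiv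
  have e2 : (ZMod (Nat.card C) →+ Q) ≃ {f : ℤ →+ Q // f (Nat.card C : ℕ) = 0} :=
    (ZMod.lift (Nat.card C)).symm
  have e3 : {f : ℤ →+ Q // f (Nat.card C : ℕ) = 0} ≃
      (nsmulAddMonoidHom (Nat.card C) : Q →+ Q).ker :=
    (zmultiplesHom Q).symm.subtypeEquiv fun f => by
      rw [AddMonoidHom.mem_ker, nsmulAddMonoidHom_apply]
      have : f (Nat.card C : ℕ) = Nat.card C • f 1 := by
        rw [← map_nsmul]; simp
      rw [this]
      rfl
  exact Nat.card_congr (e1.trans (e2.trans e3))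

theorem isAddCyclic_quotient {Q : Type*} [AddCommGroup Q] [IsAddCyclic Q] (D : AddSubgroup Q) :
    IsAddCyclic (Q ⧸ D) :=
  isAddCyclic_of_surjective (QuotientAddGroup.mk' D) (QuotientAddGroup.mk'_surjective D)

theorem card_hom_le_card (C : Type*) [AddCommGroup C] [IsAddCyclic C] [Finite C] (Q : Type*)
    [AddCommGroup Q] [Finite Q] [IsAddCyclic Q] : Nat.card (C →+ Q) ≤ Nat.card C := by
  rw [card_hom_of_isAddCyclic, IsAddCyclic.card_nsmulAddMonoidHom_ker]
  exact Nat.gcd_le_right _ Nat.card_pos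

variable (n : ℕ) [NeZero n]

theorem card_subgroup_dvd (C : AddSubgroup (ZMod n)) : Nat.card C ∣ n := by
  simpa using C.card_addSubgroup_dvd_card

/-- A subgroup of `ℤ_n` is determined by its order. -/
theorem eq_ker_nsmul (C : AddSubgroup (ZMod n)) :
    C = (nsmulAddMonoidHom (Nat.card C) : ZMod n →+ ZMod n).ker := by
  have hle : C ≤ (nsmulAddMonoidHom (Nat.card C) : ZMod n →+ ZMod n).ker := by
    intro x hx
    rw [AddMonoidHom.mem_ker, nsmulAddMonoidHom_apply]
    exact congrArg Subtype.val (card_nsmul_eq_zero' (x := (⟨x, hx⟩ : C)))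
  refine AddSubgroup.eq_of_le_of_card_ge hle ?_
  rw [IsAddCyclic.card_nsmulAddMonoidHom_ker]
  exact Nat.gcd_le_right _ Nat.card_pos

theorem card_subgroups_zmod : Nat.card (AddSubgroup (ZMod n)) = tau n := by
  have hcard : Nat.card (AddSubgroup (ZMod n)) = Nat.card n.divisors := by
    refine Nat.card_eq_of_bijective (fun C => ⟨Nat.card C, Nat.mem_divisors.2
      ⟨card_subgroup_dvd n C, NeZero.ne n⟩⟩) ⟨?_, ?_⟩
    · intro C D h
      have h' : Nat.card C = Nat.card D := Subtype.ext_iff.1 h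
      rw [eq_ker_nsmul n C, eq_ker_nsmul n D, h']
    · rintro ⟨d, hd⟩
      refine ⟨(nsmulAddMonoidHom d : ZMod n →+ ZMod n).ker, Subtype.ext ?_⟩
      simp only [IsAddCyclic.card_nsmulAddMonoidHom_ker, Nat.card_zmod]
      exact Nat.gcd_eq_right (Nat.dvd_of_mem_divisors hd)
  rw [hcard, Nat.card_eq_fintype_card, Fintype.card_coe, tau]

theorem card_hom_zmod (C : AddSubgroup (ZMod n)) :
    Nat.card (C →+ ZMod n) = Nat.card C := by
  rw [card_hom_of_isAddCyclic, IsAddCyclic.card_nsmulAddMonoidHom_ker, Nat.card_zmod]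
  exact Nat.gcd_eq_right (card_subgroup_dvd n C)

omit [NeZero n] in
theorem card_mul_card_quotient (C : AddSubgroup (ZMod n)) :
    Nat.card C * Nat.card (ZMod n ⧸ C) = n := by
  have := C.card_mul_index
  rwa [Nat.card_zmod] at this

end Cyclic

end RankThree

/-! ### The number of subgroups of `ℤ_n³` -/

namespace RankThree

section QuotientOfProduct

variable {A B : Type*} [AddCommGroup A] [AddCommGroup B] (K : AddSubgroup (A × B))

/-- The projection `(A × B) ⧸ K → A ⧸ C`, where `C` is the projection of `K` to `A`. -/
def quotientFst :
    (A × B) ⧸ K →+ A ⧸ K.map (AddMonoidHom.fst A B) :=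
  QuotientAddGroup.map K _ (AddMonoidHom.fst A B) (AddSubgroup.le_comap_map _ _)

/-- The inclusion `B ⧸ K₀ → (A × B) ⧸ K`, where `K₀` is the section `{b | (0, b) ∈ K}`. -/
def quotientInr :
    B ⧸ K.comap (AddMonoidHom.inr A B) →+ (A × B) ⧸ K :=
  QuotientAddGroup.map _ K (AddMonoidHom.inr A B) le_rfl

theorem quotientFst_surjective : Function.Surjective (quotientFst K) := by
  intro x
  obtain ⟨a, rfl⟩ := QuotientAddGroup.mk_surjective x
  exact ⟨((a, 0) : A × B), rfl⟩

theorem quotientInr_injective : Function.Injective (quotientInr K) := by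
  rw [injective_iff_map_eq_zero]
  intro x hx
  obtain ⟨b, rfl⟩ := QuotientAddGroup.mk_surjective x
  exact (QuotientAddGroup.eq_zero_iff b).2 ((QuotientAddGroup.eq_zero_iff ((0, b) : A × B)).1 hx)

theorem ker_quotientFst : (quotientFst K).ker = (quotientInr K).range := by
  ext x
  constructor
  · intro hx
    obtain ⟨⟨a, b⟩, rfl⟩ := QuotientAddGroup.mk_surjective x
    have ha : a ∈ K.map (AddMonoidHom.fst A B) := (QuotientAddGroup.eq_zero_iff a).1 hx
    obtain ⟨⟨a', b'⟩, hK, rfl⟩ := ha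
    refine ⟨((b - b' : B) : B ⧸ K.comap (AddMonoidHom.inr A B)), ?_⟩
    refine (QuotientAddGroup.eq (s := K)).2 ?_
    simpa using hK
  · rintro ⟨y, rfl⟩
    obtain ⟨b, rfl⟩ := QuotientAddGroup.mk_surjective y
    exact (QuotientAddGroup.eq_zero_iff _).2 (AddSubgroup.zero_mem _)

theorem card_quotient_prod [Finite A] [Finite B] :
    Nat.card ((A × B) ⧸ K) = Nat.card (A ⧸ K.map (AddMonoidHom.fst A B)) *
      Nat.card (B ⧸ K.comap (AddMonoidHom.inr A B)) := by
  rw [← (quotientFst K).ker.card_mul_index, AddSubgroup.index_ker, ker_quotientFst,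
    AddMonoidHom.range_eq_top.2 (quotientFst_surjective K), AddSubgroup.card_top, mul_comm,
    ← Nat.card_congr (AddMonoidHom.ofInjective (quotientInr_injective K)).toEquiv]

/-- If `B` is cyclic then so is `B ⧸ K₀`, so at most `e` of its elements are killed by `e`. -/
theorem card_torsion_quotient_prod_le [Finite A] [Finite B] [IsAddCyclic B] {e : ℕ} (he : 0 < e) :
    Nat.card (nsmulAddMonoidHom e : (A × B) ⧸ K →+ (A × B) ⧸ K).ker ≤
      e * Nat.card (A ⧸ K.map (AddMonoidHom.fst A B)) := by
  set T := (nsmulAddMonoidHom e : (A × B) ⧸ K →+ (A × B) ⧸ K).ker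
  set f : T →+ A ⧸ K.map (AddMonoidHom.fst A B) := (quotientFst K).comp T.subtype
  have hker : Nat.card f.ker ≤ e := by
    have : f.ker.map T.subtype ≤ ((nsmulAddMonoidHom e :
        (B ⧸ K.comap (AddMonoidHom.inr A B)) →+ _).ker).map (quotientInr K) := by
      rintro _ ⟨t, ht, rfl⟩
      have h1 : (t : (A × B) ⧸ K) ∈ (quotientInr K).range := by
        rw [← ker_quotientFst]; exact ht
      obtain ⟨b, hb⟩ := h1
      refine ⟨b, ?_, hb⟩
      refine quotientInr_injective K ?_
      rw [map_zero, nsmulAddMonoidHom_apply, map_nsmul, hb]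
      exact t.2
    calc Nat.card f.ker = Nat.card (f.ker.map T.subtype) :=
          (AddSubgroup.card_map_of_injective T.subtype_injective).symm
      _ ≤ Nat.card (((nsmulAddMonoidHom e :
        (B ⧸ K.comap (AddMonoidHom.inr A B)) →+ _).ker).map (quotientInr K)) :=
          Nat.card_mono (Set.toFinite _) this
      _ = _ := AddSubgroup.card_map_of_injective (quotientInr_injective K)
      _ ≤ e := by
        have : IsAddCyclic (B ⧸ K.comap (AddMonoidHom.inr A B)) := isAddCyclic_quotient _
        rw [IsAddCyclic.card_nsmulAddMonoidHom_ker]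
        exact Nat.gcd_le_right _ he
  rw [← f.ker.card_mul_index, AddSubgroup.index_ker]
  gcongr
  exact Nat.card_le_card_of_injective _ f.range.subtype_injective

end QuotientOfProduct

section Count

variable (n : ℕ) [NeZero n]

/-- The number of subgroups of `ℤ_n³` as a sum over the projection `C` to the first factor and
the section `K` in the last two factors. -/
theorem s_eq_sum_torsion [Fintype (AddSubgroup (ZMod n))]
    [Fintype (AddSubgroup (ZMod n × ZMod n))] :
    s n = ∑ C : AddSubgroup (ZMod n), ∑ K : AddSubgroup (ZMod n × ZMod n),
      Nat.card (nsmulAddMonoidHom (Nat.card C) :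
        (ZMod n × ZMod n) ⧸ K →+ (ZMod n × ZMod n) ⧸ K).ker := by
  have : Fintype (AddSubgroup (ZMod n × ZMod n × ZMod n)) := Fintype.ofFinite _
  have h1 := sum_subgroups_prod (A := ZMod n) (B := ZMod n × ZMod n) (fun _ _ => 1)
  rw [s, s₃, Nat.card_eq_fintype_card, Fintype.card_eq_sum_ones, h1]
  simp only [mul_one, card_hom_of_isAddCyclic]

/-- The contribution of `C = ℤ_n` to `s n`. As `n` kills the quotients `ℤ_n² ⧸ K`, it is the sum of
their orders; `C` and `D` on the right are the projection and the section of `K`. -/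
theorem sum_torsion_top [Fintype (AddSubgroup (ZMod n))]
    [Fintype (AddSubgroup (ZMod n × ZMod n))] :
    ∑ K : AddSubgroup (ZMod n × ZMod n), Nat.card (nsmulAddMonoidHom n :
        (ZMod n × ZMod n) ⧸ K →+ (ZMod n × ZMod n) ⧸ K).ker =
      ∑ C : AddSubgroup (ZMod n), ∑ D : AddSubgroup (ZMod n),
        Nat.card (C →+ ZMod n ⧸ D) * (Nat.card (ZMod n ⧸ C) * Nat.card (ZMod n ⧸ D)) := by
  rw [← sum_subgroups_prod (A := ZMod n) (B := ZMod n) (fun D C =>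
    Nat.card (ZMod n ⧸ C) * Nat.card (ZMod n ⧸ D))]
  refine Finset.sum_congr rfl fun K _ => ?_
  rw [← card_quotient_prod]
  have : (nsmulAddMonoidHom n : (ZMod n × ZMod n) ⧸ K →+ (ZMod n × ZMod n) ⧸ K).ker = ⊤ := by
    rw [eq_top_iff]
    intro x _
    obtain ⟨y, rfl⟩ := QuotientAddGroup.mk_surjective x
    rw [AddMonoidHom.mem_ker, nsmulAddMonoidHom_apply]
    have : n • y = 0 := by ext <;> simp
    rw [← QuotientAddGroup.mk_nsmul, this, QuotientAddGroup.mk_zero]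
  rw [this, AddSubgroup.card_top]

/-- The main term `n² τ(n)` of `s n` comes from the subgroups of `ℤ_n³` whose projection to the first
factor is full and whose section in the last factor is trivial. -/
theorem sum_bot_term [Fintype (AddSubgroup (ZMod n))] :
    ∑ C : AddSubgroup (ZMod n), Nat.card (C →+ ZMod n ⧸ (⊥ : AddSubgroup (ZMod n))) *
      (Nat.card (ZMod n ⧸ C) * Nat.card (ZMod n ⧸ (⊥ : AddSubgroup (ZMod n)))) =
      n ^ 2 * tau n := by
  have : ∀ C : AddSubgroup (ZMod n), Nat.card (C →+ ZMod n ⧸ (⊥ : AddSubgroup (ZMod n))) *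
      (Nat.card (ZMod n ⧸ C) * Nat.card (ZMod n ⧸ (⊥ : AddSubgroup (ZMod n)))) = n ^ 2 := by
    intro C
    have e : ZMod n ⧸ (⊥ : AddSubgroup (ZMod n)) ≃+ ZMod n := QuotientAddGroup.quotientBot
    rw [Nat.card_congr (e.addMonoidHomCongrRightEquiv (M := C)), Nat.card_congr e.toEquiv,
      card_hom_zmod, ← mul_assoc, card_mul_card_quotient, Nat.card_zmod, sq]
  simp only [this, Finset.sum_const, Finset.card_univ, smul_eq_mul]
  rw [← Nat.card_eq_fintype_card, card_subgroups_zmod, mul_comm]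

variable {n} {m : ℕ} (hm : ∀ d ∈ n.properDivisors, d ≤ m)

include hm

omit [NeZero n] in
theorem le_of_dvd_of_ne {d : ℕ} (hn : 0 < n) (hd : d ∣ n) (hne : d ≠ n) : d ≤ m :=
  hm d (Nat.mem_properDivisors.2 ⟨hd, lt_of_le_of_ne (Nat.le_of_dvd hn hd) hne⟩)

theorem sum_torsion_le_of_ne_top [Fintype (AddSubgroup (ZMod n))]
    [Fintype (AddSubgroup (ZMod n × ZMod n))] {C : AddSubgroup (ZMod n)} (hC : C ≠ ⊤) :
    ∑ K : AddSubgroup (ZMod n × ZMod n), Nat.card (nsmulAddMonoidHom (Nat.card C) :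
        (ZMod n × ZMod n) ⧸ K →+ (ZMod n × ZMod n) ⧸ K).ker ≤ tau n ^ 2 * (n * m) := by
  have hCm : Nat.card C ≤ m := by
    refine le_of_dvd_of_ne hm (NeZero.pos n) (card_subgroup_dvd n C) fun h => hC ?_
    exact AddSubgroup.eq_top_of_card_eq C (by rw [h, Nat.card_zmod])
  calc _ ≤ ∑ K : AddSubgroup (ZMod n × ZMod n),
          m * Nat.card (ZMod n ⧸ K.map (AddMonoidHom.fst (ZMod n) (ZMod n))) :=
        Finset.sum_le_sum fun K _ => (card_torsion_quotient_prod_le K Nat.card_pos).trans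
          (Nat.mul_le_mul_right _ hCm)
    _ = ∑ C : AddSubgroup (ZMod n), ∑ D : AddSubgroup (ZMod n),
          Nat.card (C →+ ZMod n ⧸ D) * (m * Nat.card (ZMod n ⧸ C)) :=
        sum_subgroups_prod (A := ZMod n) (B := ZMod n) (fun _ C => m * Nat.card (ZMod n ⧸ C))
    _ ≤ ∑ C : AddSubgroup (ZMod n), ∑ D : AddSubgroup (ZMod n), n * m := by
        refine Finset.sum_le_sum fun C _ => Finset.sum_le_sum fun D _ => ?_
        have := isAddCyclic_quotient D
        calc _ ≤ Nat.card C * (m * Nat.card (ZMod n ⧸ C)) :=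
              Nat.mul_le_mul_right _ (card_hom_le_card _ _)
          _ = (Nat.card C * Nat.card (ZMod n ⧸ C)) * m := by ring
          _ = n * m := by rw [card_mul_card_quotient]
    _ = tau n ^ 2 * (n * m) := by
        simp only [Finset.sum_const, Finset.card_univ, smul_eq_mul]
        rw [← Nat.card_eq_fintype_card, card_subgroups_zmod]
        ring

theorem sum_le_of_ne_bot [Fintype (AddSubgroup (ZMod n))] {D : AddSubgroup (ZMod n)}
    (hD : D ≠ ⊥) :
    ∑ C : AddSubgroup (ZMod n), Nat.card (C →+ ZMod n ⧸ D) *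
      (Nat.card (ZMod n ⧸ C) * Nat.card (ZMod n ⧸ D)) ≤ tau n * (n * m) := by
  have hDm : Nat.card (ZMod n ⧸ D) ≤ m := by
    have h1 := card_mul_card_quotient n D
    refine le_of_dvd_of_ne hm (NeZero.pos n) (Dvd.intro_left _ h1) fun h => hD ?_
    rw [h] at h1
    exact AddSubgroup.eq_bot_of_card_eq D
      (Nat.eq_of_mul_eq_mul_right (NeZero.pos n) (by rw [h1, one_mul]))
  calc _ ≤ ∑ C : AddSubgroup (ZMod n), n * m := by
        refine Finset.sum_le_sum fun C _ => ?_
        have := isAddCyclic_quotient D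
        calc _ ≤ Nat.card C * (Nat.card (ZMod n ⧸ C) * m) :=
              Nat.mul_le_mul (card_hom_le_card _ _) (Nat.mul_le_mul_left _ hDm)
          _ = n * m := by rw [← mul_assoc, card_mul_card_quotient]
    _ = _ := by
        simp only [Finset.sum_const, Finset.card_univ, smul_eq_mul]
        rw [← Nat.card_eq_fintype_card, card_subgroups_zmod]

theorem sum_torsion_top_le [Fintype (AddSubgroup (ZMod n))]
    [Fintype (AddSubgroup (ZMod n × ZMod n))] :
    ∑ K : AddSubgroup (ZMod n × ZMod n), Nat.card (nsmulAddMonoidHom n :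
        (ZMod n × ZMod n) ⧸ K →+ (ZMod n × ZMod n) ⧸ K).ker ≤
      n ^ 2 * tau n + (tau n - 1) * (tau n * (n * m)) := by
  classical
  rw [sum_torsion_top, Finset.sum_comm, ← Finset.add_sum_erase _ _ (Finset.mem_univ ⊥),
    sum_bot_term]
  gcongr
  refine (Finset.sum_le_card_nsmul _ _ _ fun D hD =>
    sum_le_of_ne_bot hm (Finset.ne_of_mem_erase hD)).trans_eq ?_
  rw [Finset.card_erase_of_mem (Finset.mem_univ _), Finset.card_univ,
    ← Nat.card_eq_fintype_card, card_subgroups_zmod, smul_eq_mul]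

omit hm in
theorem le_s : n ^ 2 * tau n ≤ s n := by
  classical
  have : Fintype (AddSubgroup (ZMod n)) := Fintype.ofFinite _
  have : Fintype (AddSubgroup (ZMod n × ZMod n)) := Fintype.ofFinite _
  rw [s_eq_sum_torsion, ← Finset.add_sum_erase _ _ (Finset.mem_univ ⊤), AddSubgroup.card_top,
    Nat.card_zmod, sum_torsion_top, Finset.sum_comm,
    ← Finset.add_sum_erase _ _ (Finset.mem_univ ⊥), sum_bot_term, add_assoc]
  exact Nat.le_add_right _ _

/-- The number of subgroups of `ℤ_n³` exceeds `n² τ(n)` only by a quantity smaller by a factor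
`n / m`, up to powers of `τ(n)`; here `m` bounds the proper divisors of `n`. -/
theorem s_le : s n ≤ n ^ 2 * tau n + tau n ^ 3 * (n * m) := by
  classical
  have : Fintype (AddSubgroup (ZMod n)) := Fintype.ofFinite _
  have : Fintype (AddSubgroup (ZMod n × ZMod n)) := Fintype.ofFinite _
  have htau : 1 ≤ tau n := by
    rw [← card_subgroups_zmod]; exact Nat.card_pos
  rw [s_eq_sum_torsion, ← Finset.add_sum_erase _ _ (Finset.mem_univ ⊤), AddSubgroup.card_top,
    Nat.card_zmod]
  have h1 := sum_torsion_top_le hm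
  have h2 := Finset.sum_le_card_nsmul (Finset.univ.erase (⊤ : AddSubgroup (ZMod n))) _ _
    fun C hC => sum_torsion_le_of_ne_top hm (Finset.ne_of_mem_erase hC)
  rw [Finset.card_erase_of_mem (Finset.mem_univ _), Finset.card_univ,
    ← Nat.card_eq_fintype_card, card_subgroups_zmod, smul_eq_mul] at h2
  refine (Nat.add_le_add h1 h2).trans ?_
  obtain ⟨t, ht⟩ := Nat.exists_eq_add_of_le' htau
  rw [ht]
  simp only [Nat.add_sub_cancel]
  have : t * ((t + 1) * (n * m)) + t * ((t + 1) ^ 2 * (n * m)) ≤ (t + 1) ^ 3 * (n * m) := by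
    have : t * (t + 1) + t * (t + 1) ^ 2 ≤ (t + 1) ^ 3 := by nlinarith
    nlinarith [Nat.mul_le_mul_right (n * m) this]
  linarith

end Count

end RankThree

/-! ### Multiplicativity of `h` and its values at prime powers -/

namespace RankThree

section Multiplicative

/-- By the Chinese remainder theorem some multiple of `(x, y)` is `(x, 0)`. -/
theorem exists_nsmul_eq_of_coprime {G H : Type*} [AddCommGroup G] [AddCommGroup H]
    (hc : (Nat.card G).Coprime (Nat.card H)) (x : G) (y : H) :
    ∃ k : ℕ, k • x = x ∧ k • y = 0 := by
  obtain ⟨k, hk1, hk2⟩ := Nat.chineseRemainder hc 1 0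
  refine ⟨k, ?_, ?_⟩
  · have := (addOrderOf_dvd_natCard x)
    simpa using (nsmul_eq_nsmul_iff_modEq (x := x) (n := k) (m := 1)).2 (hk1.of_dvd this)
  · have := (addOrderOf_dvd_natCard y)
    simpa using (nsmul_eq_nsmul_iff_modEq (x := y) (n := k) (m := 0)).2 (hk2.of_dvd this)

/-- A subgroup of a product of two groups of coprime orders is a product of subgroups. -/
theorem card_subgroups_prod_of_coprime {G H : Type*} [AddCommGroup G] [AddCommGroup H]
    (hc : (Nat.card G).Coprime (Nat.card H)) :
    Nat.card (AddSubgroup (G × H)) = Nat.card (AddSubgroup G) * Nat.card (AddSubgroup H) := by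
  rw [← Nat.card_prod]
  symm
  refine Nat.card_eq_of_bijective (fun K => K.1.prod K.2) ⟨?_, ?_⟩
  · rintro ⟨K, L⟩ ⟨K', L'⟩ h
    have h' : ∀ x y, (x ∈ K ∧ y ∈ L) ↔ (x ∈ K' ∧ y ∈ L') := fun x y => by
      have := SetLike.ext_iff.1 h (x, y)
      simpa only [AddSubgroup.mem_prod] using this
    rw [Prod.mk.injEq]
    constructor
    · ext x
      simpa [zero_mem] using h' x 0
    · ext y
      simpa [zero_mem] using h' 0 y
  · intro M
    refine ⟨(M.map (AddMonoidHom.fst G H), M.map (AddMonoidHom.snd G H)), ?_⟩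
    ext ⟨x, y⟩
    rw [AddSubgroup.mem_prod]
    constructor
    · rintro ⟨⟨⟨x', y'⟩, hx, rfl⟩, ⟨⟨x'', y''⟩, hy, rfl⟩⟩
      obtain ⟨k, hk1, hk2⟩ := exists_nsmul_eq_of_coprime hc x' y'
      obtain ⟨l, hl1, hl2⟩ := exists_nsmul_eq_of_coprime hc.symm y'' x''
      have h1 := M.nsmul_mem hx k
      have h2 := M.nsmul_mem hy l
      have h3 := M.add_mem h1 h2
      simpa [hk1, hk2, hl1, hl2] using h3
    · intro h
      exact ⟨⟨_, h, rfl⟩, ⟨_, h, rfl⟩⟩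

theorem s_mul_of_coprime {m n : ℕ} (hc : m.Coprime n) :
    s (m * n) = s m * s n := by
  let e := ZMod.chineseRemainder hc
  let e' : ZMod (m * n) ≃+ ZMod m × ZMod n := e.toAddEquiv
  let E : (ZMod (m * n) × ZMod (m * n) × ZMod (m * n)) ≃+
      (ZMod m × ZMod m × ZMod m) × (ZMod n × ZMod n × ZMod n) :=
    (e'.prodCongr ((e'.prodCongr e').trans (AddEquiv.prodProdProdComm _ _ _ _))).trans
      (AddEquiv.prodProdProdComm _ _ _ _)
  rw [s, s₃, Nat.card_congr E.mapAddSubgroup.toEquiv, card_subgroups_prod_of_coprime]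
  · rfl
  · simp only [Nat.card_prod, Nat.card_zmod]
    simpa [Nat.coprime_mul_iff_left, Nat.coprime_mul_iff_right] using hc

theorem s_one : s 1 = 1 := by
  rw [s, s₃, Nat.card_eq_one_iff_unique]
  exact ⟨inferInstance, inferInstance⟩

open ArithmeticFunction

/-- The arithmetic function `n ↦ n²`. -/
def sqFun : ArithmeticFunction ℤ := ⟨fun n => (n : ℤ) ^ 2, by simp⟩

/-- The arithmetic function `n ↦ n² μ(n)`, the Dirichlet inverse of `n ↦ n²`. -/
def sqMoebius : ArithmeticFunction ℤ := ⟨fun n => (n : ℤ) ^ 2 * moebius n, by simp⟩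

/-- `s` as an arithmetic function; its value at `0` is set to `0`. -/
noncomputable def sFun : ArithmeticFunction ℤ := ⟨fun n => if n = 0 then 0 else (s n : ℤ), by simp⟩

/-- The Dirichlet convolution of `s` with the inverse of `n ↦ n² τ(n)`, which is `h`
(see `h_eq_hFun`). -/
noncomputable def hFun : ArithmeticFunction ℤ := sFun * sqMoebius * sqMoebius

theorem sqFun_mul_sqMoebius : sqFun * sqMoebius = 1 := by
  ext n
  have h1 : (sqFun * sqMoebius) n = (n : ℤ) ^ 2 * ((zeta : ArithmeticFunction ℤ) * moebius) n := by
    rw [mul_apply, mul_apply, Finset.mul_sum]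
    refine Finset.sum_congr rfl fun x hx => ?_
    obtain ⟨hx1, hx2⟩ := Nat.mem_divisorsAntidiagonal.1 hx
    have : x.1 ≠ 0 := by rintro h0; simp [h0] at hx1; exact hx2 hx1.symm
    rw [← hx1, natCoe_apply, zeta_apply_ne this]
    simp only [sqFun, sqMoebius, coe_mk]
    push_cast
    ring
  rw [h1, coe_zeta_mul_moebius]
  rcases eq_or_ne n 1 with rfl | hn
  · simp
  · simp [one_apply_ne hn]

theorem sqFun_mul_sqFun (n : ℕ) : (sqFun * sqFun) n = (n : ℤ) ^ 2 * tau n := by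
  rw [mul_apply]
  have : ∀ x ∈ n.divisorsAntidiagonal, sqFun x.1 * sqFun x.2 = (n : ℤ) ^ 2 := by
    intro x hx
    obtain ⟨hx1, hx2⟩ := Nat.mem_divisorsAntidiagonal.1 hx
    rw [← hx1]
    simp only [sqFun, coe_mk]
    push_cast
    ring
  rw [Finset.sum_congr rfl this, Finset.sum_const, tau, nsmul_eq_mul, mul_comm,
    ← Nat.map_div_right_divisors, Finset.card_map]

theorem sFun_eq_hFun_mul : sFun = hFun * (sqFun * sqFun) := by
  calc sFun = sFun * (sqFun * sqMoebius) * (sqFun * sqMoebius) := by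
        rw [sqFun_mul_sqMoebius]; simp
    _ = _ := by rw [hFun]; ring

theorem h_eq_hFun {n : ℕ} (hn : 1 ≤ n) : h n = hFun n := by
  symm
  refine eq_h_of_s_eq_sum (fun n => hFun n) (fun n hn => ?_) n hn
  have h2 : (s n : ℤ) = sFun n := by
    simp only [sFun, coe_mk]
    rw [if_neg (by omega)]
  rw [h2, sFun_eq_hFun_mul, mul_comm, mul_apply, Nat.sum_divisorsAntidiagonal
    (fun x y => (sqFun * sqFun) x * hFun y)]
  simp only [sqFun_mul_sqFun]

theorem isMultiplicative_sFun : sFun.IsMultiplicative := by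
  rw [IsMultiplicative.iff_ne_zero]
  refine ⟨by simp [sFun, s_one], fun {m n} hm hn hc => ?_⟩
  simp [sFun, hm, hn, s_mul_of_coprime hc]

theorem isMultiplicative_sqMoebius : sqMoebius.IsMultiplicative := by
  rw [IsMultiplicative.iff_ne_zero]
  refine ⟨by simp [sqMoebius], fun {m n} hm hn hc => ?_⟩
  simp only [sqMoebius, coe_mk, isMultiplicative_moebius.map_mul_of_coprime hc]
  push_cast
  ring

theorem isMultiplicative_hFun : hFun.IsMultiplicative :=
  (isMultiplicative_sFun.mul isMultiplicative_sqMoebius).mul isMultiplicative_sqMoebius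

theorem mul_sqMoebius_prime_pow_succ (f : ArithmeticFunction ℤ) {p : ℕ} (hp : p.Prime) (k : ℕ) :
    (f * sqMoebius) (p ^ (k + 1)) = f (p ^ (k + 1)) - (p : ℤ) ^ 2 * f (p ^ k) := by
  rw [mul_comm, mul_apply, Nat.sum_divisorsAntidiagonal (fun x y => sqMoebius x * f y),
    Nat.sum_divisors_prime_pow hp, Finset.sum_range_succ', Finset.sum_range_succ',
    Finset.sum_eq_zero]
  · simp only [sqMoebius, coe_mk, zero_add, pow_zero, pow_one, Nat.div_one, moebius_apply_prime hp,
      moebius_apply_one, pow_succ p k, Nat.mul_div_cancel _ hp.pos]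
    push_cast
    ring
  · intro i _
    simp [sqMoebius, moebius_apply_prime_pow hp (show i + 1 + 1 ≠ 0 by omega)]

theorem mul_sqMoebius_one (f : ArithmeticFunction ℤ) : (f * sqMoebius) 1 = f 1 := by
  rw [mul_apply_one]
  simp [sqMoebius]

end Multiplicative

section PrimePower

variable {p : ℕ} (hp : p.Prime)

include hp

theorem tau_prime_pow (k : ℕ) : tau (p ^ k) = k + 1 := by
  rw [tau, Nat.divisors_prime_pow hp, Finset.card_map, Finset.card_range]

/-- The excess of `s(p^k)` over its main term `(k + 1) p^{2k}` is smaller by a factor `p`. -/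
theorem s_prime_pow_bounds (k : ℕ) :
    0 ≤ (s (p ^ k) : ℤ) - (k + 1) * (p : ℤ) ^ (2 * k) ∧
    p * ((s (p ^ k) : ℤ) - (k + 1) * (p : ℤ) ^ (2 * k)) ≤ (k + 1) ^ 3 * (p : ℤ) ^ (2 * k) := by
  have : NeZero (p ^ k) := ⟨(pow_pos hp.pos k).ne'⟩
  constructor
  · have h1 := le_s (n := p ^ k)
    rw [tau_prime_pow hp] at h1
    have h2 : ((p ^ k) ^ 2 * (k + 1) : ℤ) ≤ s (p ^ k) := by exact_mod_cast h1
    have h3 : (p : ℤ) ^ (2 * k) = (p ^ k) ^ 2 := by ring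
    rw [h3]; linarith
  · rcases k with _ | k
    · simp [s_one]
    · have hm : ∀ d ∈ (p ^ (k + 1)).properDivisors, d ≤ p ^ k := by
        intro d hd
        rw [Nat.properDivisors_prime_pow hp] at hd
        simp only [Finset.mem_map, Finset.mem_range, Function.Embedding.coeFn_mk] at hd
        obtain ⟨i, hi, rfl⟩ := hd
        exact Nat.pow_le_pow_right hp.pos (by omega)
      have h1 := s_le hm
      rw [tau_prime_pow hp] at h1
      have h2 : (s (p ^ (k + 1)) : ℤ) ≤ (p ^ (k + 1)) ^ 2 * ((k : ℤ) + 1 + 1) +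
          ((k : ℤ) + 1 + 1) ^ 3 * (p ^ (k + 1) * p ^ k) := by exact_mod_cast h1
      have h3 : (p : ℤ) ^ (2 * (k + 1)) = (p ^ (k + 1)) ^ 2 := by ring
      have hp0 : (0 : ℤ) ≤ p := by positivity
      have h4 : (s (p ^ (k + 1)) : ℤ) - ((k : ℤ) + 1 + 1) * (p ^ (k + 1)) ^ 2 ≤
        ((k : ℤ) + 1 + 1) ^ 3 * (p ^ (k + 1) * p ^ k) := by linarith
      rw [h3]
      push_cast
      calc _ ≤ (p : ℤ) * (((k : ℤ) + 1 + 1) ^ 3 * (p ^ (k + 1) * p ^ k)) :=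
            mul_le_mul_of_nonneg_left h4 hp0
        _ = _ := by ring

theorem hFun_prime : hFun p = (s p : ℤ) - 2 * p ^ 2 := by
  have h1 := mul_sqMoebius_prime_pow_succ (sFun * sqMoebius) hp 0
  have h2 := mul_sqMoebius_prime_pow_succ sFun hp 0
  simp only [zero_add, pow_one, pow_zero, mul_sqMoebius_one] at h1 h2
  rw [hFun, h1, h2]
  simp [sFun, hp.ne_zero, s_one]
  ring

theorem hFun_prime_pow_add_two (k : ℕ) : hFun (p ^ (k + 2)) =
    (s (p ^ (k + 2)) : ℤ) - 2 * p ^ 2 * s (p ^ (k + 1)) + p ^ 4 * s (p ^ k) := by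
  rw [hFun, mul_sqMoebius_prime_pow_succ _ hp, mul_sqMoebius_prime_pow_succ _ hp,
    mul_sqMoebius_prime_pow_succ _ hp]
  simp [sFun, hp.ne_zero]
  ring

/-- The main terms `(k + 1) p^{2k}` of `s(p^k)` form an arithmetic progression up to the factor
`p^{2k}`, so they cancel in `h(p^k)`. -/
theorem abs_hFun_prime_pow_le {k : ℕ} (hk : 1 ≤ k) :
    p * |hFun (p ^ k)| ≤ 4 * (k + 1) ^ 3 * (p : ℤ) ^ (2 * k) := by
  have hp0 : (0 : ℤ) ≤ p := by positivity
  rw [← abs_of_nonneg hp0, ← abs_mul, abs_of_nonneg hp0]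
  obtain _ | _ | k := k
  · omega
  · obtain ⟨h1, h2⟩ := s_prime_pow_bounds hp 1
    simp only [zero_add, pow_one, hFun_prime hp] at *
    have hnn := mul_nonneg hp0 h1
    have : (0 : ℤ) ≤ (p : ℤ) ^ (2 * 1) := by positivity
    push_cast at *
    rw [abs_le]
    constructor <;> nlinarith
  · obtain ⟨h1, h2⟩ := s_prime_pow_bounds hp (k + 2)
    obtain ⟨h3, h4⟩ := s_prime_pow_bounds hp (k + 1)
    obtain ⟨h5, h6⟩ := s_prime_pow_bounds hp k
    rw [show k + 1 + 1 = k + 2 from rfl, hFun_prime_pow_add_two hp]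
    have e1 : (p : ℤ) ^ (2 * (k + 1)) = p ^ (2 * k) * p ^ 2 := by ring
    have e2 : (p : ℤ) ^ (2 * (k + 2)) = p ^ (2 * k) * p ^ 4 := by ring
    rw [e2] at h1 h2 ⊢
    rw [e1] at h3 h4
    set r0 := (s (p ^ k) : ℤ) - (k + 1) * (p : ℤ) ^ (2 * k)
    set r1 := (s (p ^ (k + 1)) : ℤ) - ((k + 1 : ℕ) + 1) * ((p : ℤ) ^ (2 * k) * p ^ 2) with hr1
    set r2 := (s (p ^ (k + 2)) : ℤ) - ((k + 2 : ℕ) + 1) * ((p : ℤ) ^ (2 * k) * p ^ 4) with hr2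
    have e3 : (s (p ^ (k + 2)) : ℤ) - 2 * p ^ 2 * s (p ^ (k + 1)) + p ^ 4 * s (p ^ k) =
        r2 - 2 * p ^ 2 * r1 + p ^ 4 * r0 := by
      simp only [r0, r1, r2]; push_cast; ring
    rw [e3]
    have g1 := mul_nonneg hp0 h1
    have g3 := mul_nonneg (sq_nonneg (p : ℤ)) (mul_nonneg hp0 h3)
    have g5 := mul_nonneg (pow_nonneg hp0 4) (mul_nonneg hp0 h5)
    have g4 := mul_le_mul_of_nonneg_left h4 (sq_nonneg (p : ℤ))
    have g6 := mul_le_mul_of_nonneg_left h6 (pow_nonneg hp0 4)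
    set Q : ℤ := (p : ℤ) ^ (2 * k) * p ^ 4 with hQ
    have hQ0 : 0 ≤ Q := by positivity
    have g4' : (p : ℤ) ^ 2 * (p * r1) ≤ (k + 2) ^ 3 * Q := by
      refine g4.trans_eq ?_
      rw [hQ]; push_cast; ring
    have g6' : (p : ℤ) ^ 4 * (p * r0) ≤ (k + 1) ^ 3 * Q := by
      refine g6.trans_eq ?_
      rw [hQ]; ring
    have g2' : (p : ℤ) * r2 ≤ (k + 3) ^ 3 * Q := by
      refine h2.trans_eq ?_
      push_cast; ring
    have c1 : ((k : ℤ) + 2) ^ 3 * Q ≤ (k + 3) ^ 3 * Q := by gcongr; norm_num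
    have c2 : ((k : ℤ) + 1) ^ 3 * Q ≤ (k + 3) ^ 3 * Q := by gcongr; norm_num
    have c3 : 4 * (((k + 2 : ℕ) : ℤ) + 1) ^ 3 * Q = 4 * ((k + 3) ^ 3 * Q) := by push_cast; ring
    have e4 : (p : ℤ) * (r2 - 2 * p ^ 2 * r1 + p ^ 4 * r0) =
      p * r2 - 2 * (p ^ 2 * (p * r1)) + p ^ 4 * (p * r0) := by ring
    rw [c3, e4, abs_le]
    have : 0 ≤ ((k : ℤ) + 3) ^ 3 * Q := by positivity
    constructor <;> linarith

end PrimePower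

end RankThree

/-! ### Absolute convergence of the Dirichlet series of `h` -/

namespace RankThree

/-- A nonnegative multiplicative function is summable as soon as its sum over the proper prime
powers is, by comparing the Euler product with an exponential. -/
theorem summable_of_tsum_prime_pow_le {f ε : ℕ → ℝ} (hf : ∀ n, 0 ≤ f n) (hf0 : f 0 = 0)
    (hf1 : f 1 = 1) (hmul : ∀ {m n : ℕ}, m.Coprime n → f (m * n) = f m * f n)
    (hε : ∀ n, 0 ≤ ε n) (hεs : Summable ε)
    (hsum : ∀ p : ℕ, p.Prime → Summable (fun k => f (p ^ (k + 1))))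
    (hle : ∀ p : ℕ, p.Prime → ∑' k, f (p ^ (k + 1)) ≤ ε p) : Summable f := by
  have hsum' : ∀ {p : ℕ}, p.Prime → Summable (fun k => ‖f (p ^ k)‖) := by
    intro p hp
    simp only [Real.norm_of_nonneg (hf _)]
    exact (summable_nat_add_iff 1).1 (hsum p hp)
  refine summable_of_sum_range_le (c := Real.exp (∑' n, ε n)) hf fun N => ?_
  obtain ⟨h1, h2⟩ := EulerProduct.summable_and_hasSum_smoothNumbers_prod_primesBelow_tsum
    hf1 hmul hsum' N
  have h3 : ∑ i ∈ Finset.range N, f i ≤ ∏ p ∈ N.primesBelow, ∑' k, f (p ^ k) := by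
    rw [← h2.tsum_eq]
    have h4 : ∑ i ∈ Finset.range N, f i = ∑ i ∈ (Finset.range N).erase 0, f i := by
      rw [Finset.sum_erase _ hf0]
    have hmem : ∀ i ∈ (Finset.range N).erase 0, i ∈ N.smoothNumbers := by
      intro i hi
      rw [Finset.mem_erase, Finset.mem_range] at hi
      exact Nat.mem_smoothNumbers_of_lt (Nat.pos_of_ne_zero hi.1) hi.2
    rw [h4, ← Finset.sum_subtype_of_mem f hmem]
    exact h2.summable.sum_le_tsum _ fun i _ => hf i
  refine h3.trans ?_
  calc ∏ p ∈ N.primesBelow, ∑' k, f (p ^ k) ≤ ∏ p ∈ N.primesBelow, Real.exp (ε p) := by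
        refine Finset.prod_le_prod (fun p _ => tsum_nonneg fun k => hf _) fun p hp => ?_
        have hp' := Nat.prime_of_mem_primesBelow hp
        have hs : Summable (fun k => f (p ^ k)) := (hsum' hp').of_norm
        rw [hs.tsum_eq_zero_add, pow_zero, hf1]
        linarith [hle p hp', Real.add_one_le_exp (ε p)]
    _ = Real.exp (∑ p ∈ N.primesBelow, ε p) := (Real.exp_sum _ _).symm
    _ ≤ _ := Real.exp_le_exp.2 (hεs.sum_le_tsum _ fun i _ => hε i)

theorem summable_add_two_pow_mul_geometric {r : ℝ} (h0 : 0 < r) (h1 : r < 1) :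
    Summable (fun k : ℕ => ((k : ℝ) + 2) ^ 3 * r ^ k) := by
  have h2 := summable_pow_mul_geometric_of_norm_lt_one (R := ℝ) 3
    (show ‖r‖ < 1 by rwa [Real.norm_of_nonneg h0.le])
  have h3 := ((summable_nat_add_iff 2).2 h2).mul_right ((r ^ 2)⁻¹)
  refine h3.congr fun k => ?_
  push_cast
  field_simp
  ring

/-- The terms of the Dirichlet series of `|h|` at `2 + δ` over the powers of `p` are dominated by
`p^{-(1 + δ)}` times a convergent series that does not depend on `p`. -/
theorem abs_hFun_mul_rpow_le {δ : ℝ} (hδ : 0 < δ) {p : ℕ} (hp : p.Prime) (k : ℕ) :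
    |(hFun (p ^ (k + 1)) : ℝ)| * ((p ^ (k + 1) : ℕ) : ℝ) ^ (-(2 + δ)) ≤
      4 * (p : ℝ) ^ (-(1 + δ)) * (((k : ℝ) + 2) ^ 3 * ((2 : ℝ) ^ (-δ)) ^ k) := by
  have hp0 : (0 : ℝ) < p := by exact_mod_cast hp.pos
  have h1 : (p : ℝ) * |(hFun (p ^ (k + 1)) : ℝ)| ≤
      4 * ((k : ℝ) + 2) ^ 3 * (p : ℝ) ^ (2 * (k + 1)) := by
    have := abs_hFun_prime_pow_le hp (k := k + 1) (by omega)
    have h2 : ((p * |hFun (p ^ (k + 1))| : ℤ) : ℝ) ≤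
        ((4 * ((k + 1 : ℕ) + 1) ^ 3 * (p : ℤ) ^ (2 * (k + 1)) : ℤ) : ℝ) := by exact_mod_cast this
    push_cast at h2
    rwa [show ((k : ℝ) + 1 + 1) = k + 2 by ring] at h2
  have h2 : |(hFun (p ^ (k + 1)) : ℝ)| ≤
      4 * ((k : ℝ) + 2) ^ 3 * ((p : ℝ) ^ (2 * (k + 1)) * (p : ℝ)⁻¹) := by
    rw [← mul_assoc, ← div_eq_mul_inv, le_div_iff₀ hp0, mul_comm]
    exact h1
  have h3 : ((p ^ (k + 1) : ℕ) : ℝ) ^ (-(2 + δ)) =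
      ((p : ℝ) ^ (2 * (k + 1)))⁻¹ * ((p : ℝ) ^ (-δ) * ((p : ℝ) ^ (-δ)) ^ k) := by
    push_cast
    rw [← Real.rpow_natCast (p : ℝ) (2 * (k + 1)), ← Real.rpow_neg hp0.le, ← pow_succ',
      ← Real.rpow_natCast (p : ℝ) (k + 1), ← Real.rpow_natCast _ (k + 1), ← Real.rpow_mul hp0.le,
      ← Real.rpow_mul hp0.le, ← Real.rpow_add hp0]
    congr 1
    push_cast
    ring
  have h4 : ((p : ℝ) ^ (-δ)) ^ k ≤ ((2 : ℝ) ^ (-δ)) ^ k := by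
    refine pow_le_pow_left₀ (by positivity) ?_ k
    exact Real.rpow_le_rpow_of_nonpos two_pos (by exact_mod_cast hp.two_le) (by linarith)
  have h5 : (p : ℝ) ^ (-(1 + δ)) = (p : ℝ)⁻¹ * (p : ℝ) ^ (-δ) := by
    rw [← Real.rpow_neg_one, ← Real.rpow_add hp0]
    congr 1; ring
  have hpk : (p : ℝ) ^ (2 * (k + 1)) ≠ 0 := by positivity
  calc _ ≤ 4 * ((k : ℝ) + 2) ^ 3 * ((p : ℝ) ^ (2 * (k + 1)) * (p : ℝ)⁻¹) *
        (((p : ℝ) ^ (2 * (k + 1)))⁻¹ * ((p : ℝ) ^ (-δ) * ((p : ℝ) ^ (-δ)) ^ k)) := by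
        rw [h3]; gcongr
    _ = 4 * ((k : ℝ) + 2) ^ 3 * (p : ℝ)⁻¹ * (p : ℝ) ^ (-δ) * ((p : ℝ) ^ (-δ)) ^ k := by
        field_simp
    _ ≤ 4 * ((k : ℝ) + 2) ^ 3 * (p : ℝ)⁻¹ * (p : ℝ) ^ (-δ) * ((2 : ℝ) ^ (-δ)) ^ k := by
        gcongr
    _ = _ := by rw [h5]; ring

theorem summable_abs_hFun_mul_rpow {δ : ℝ} (hδ : 0 < δ) :
    Summable (fun n : ℕ => |(hFun n : ℝ)| * (n : ℝ) ^ (-(2 + δ))) := by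
  have hr : (2 : ℝ) ^ (-δ) < 1 := Real.rpow_lt_one_of_one_lt_of_neg one_lt_two (by linarith)
  have hgeo := summable_add_two_pow_mul_geometric (Real.rpow_pos_of_pos two_pos (-δ)) hr
  have hsum : ∀ p : ℕ, p.Prime → Summable (fun k =>
      |(hFun (p ^ (k + 1)) : ℝ)| * ((p ^ (k + 1) : ℕ) : ℝ) ^ (-(2 + δ))) := fun p hp =>
    Summable.of_nonneg_of_le (fun k => by positivity) (abs_hFun_mul_rpow_le hδ hp)
      (hgeo.mul_left _)
  refine summable_of_tsum_prime_pow_le (ε := fun n => 4 * (n : ℝ) ^ (-(1 + δ)) *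
    ∑' k : ℕ, (((k : ℝ) + 2) ^ 3 * ((2 : ℝ) ^ (-δ)) ^ k)) (fun n => by positivity) (by simp)
    (by simp [isMultiplicative_hFun.map_one]) ?_ ?_ ?_ hsum ?_
  · intro m n hc
    rw [isMultiplicative_hFun.map_mul_of_coprime hc]
    push_cast
    rw [abs_mul, Real.mul_rpow (by positivity) (by positivity)]
    ring
  · intro n
    have : 0 ≤ ∑' k : ℕ, (((k : ℝ) + 2) ^ 3 * ((2 : ℝ) ^ (-δ)) ^ k) :=
      tsum_nonneg fun k => by positivity
    positivity
  · exact ((Real.summable_nat_rpow.2 (by linarith)).mul_left 4).mul_right _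
  · intro p hp
    rw [← tsum_mul_left]
    exact (hsum p hp).tsum_le_tsum (abs_hFun_mul_rpow_le hδ hp) (hgeo.mul_left _)

theorem summable_abs_h_mul_rpow {σ : ℝ} (hσ : 2 < σ) :
    Summable (fun n : ℕ => |(h n : ℝ)| * (n : ℝ) ^ (-σ)) := by
  refine (summable_abs_hFun_mul_rpow (sub_pos.2 hσ)).congr fun n => ?_
  rw [show 2 + (σ - 2) = σ by ring]
  rcases Nat.eq_zero_or_pos n with rfl | hn
  · rw [Nat.cast_zero, Real.zero_rpow (by linarith)]; simp
  · rw [h_eq_hFun hn]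

theorem abscissaOfAbsConv_h_le : LSeries.abscissaOfAbsConv (fun n => (h n : ℂ)) ≤ 2 := by
  refine LSeries.abscissaOfAbsConv_le_of_forall_lt_LSeriesSummable (x := 2) fun y hy => ?_
  refine Summable.of_norm ((summable_abs_h_mul_rpow hy).congr fun n => ?_)
  rw [LSeries.norm_term_eq]
  split_ifs with hn
  · rw [hn, Nat.cast_zero, Real.zero_rpow (by linarith), mul_zero]
  · rw [Real.rpow_neg (by positivity), div_eq_mul_inv, Complex.norm_intCast, Complex.ofReal_re]

theorem abscissaOfAbsConv_h_lt : LSeries.abscissaOfAbsConv (fun n => (h n : ℂ)) < 3 :=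
  abscissaOfAbsConv_h_le.trans_lt (by exact_mod_cast (by norm_num : (2 : ℝ) < 3))

end RankThree

/-! ### The summatory function of `n² τ(n)` -/

namespace RankThree

open Filter Asymptotics MeasureTheory

/-- The main term `x log x + (2γ - 1) x` of the divisor problem. -/
noncomputable def divisorMain (x : ℝ) : ℝ :=
  x * Real.log x + (2 * Real.eulerMascheroniConstant - 1) * x

/-- The summatory function of `n² τ(n)`. -/
noncomputable def sumSqTau (x : ℝ) : ℝ := ∑ n ∈ Finset.Icc 1 ⌊x⌋₊, (n : ℝ) ^ 2 * tau n

/-- The main term `x³/3 (log x + 2γ - 1/3)` of the summatory function of `n² τ(n)`. -/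
noncomputable def sqTauMain (x : ℝ) : ℝ :=
  x ^ 3 / 3 * (Real.log x + 2 * Real.eulerMascheroniConstant - 1 / 3)

/-- The error in the divisor problem is unbounded: the sum is constant on `[n, n + 1/2]`, whereas
the main term grows there by at least a constant plus `log n / 2`. -/
theorem pos_of_isBigO_divisor {η : ℝ}
    (hη : (fun x : ℝ => (∑ n ∈ Finset.Icc 1 ⌊x⌋₊, (tau n : ℝ)) - divisorMain x)
      =O[atTop] (fun x : ℝ => x ^ η)) : 0 < η := by
  by_contra! hneg
  obtain ⟨C, hC⟩ := hη.bound
  have hb : ∀ᶠ x : ℝ in atTop,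
      |(∑ n ∈ Finset.Icc 1 ⌊x⌋₊, (tau n : ℝ)) - divisorMain x| ≤ |C| := by
    filter_upwards [hC, eventually_ge_atTop 1] with x hx hx1
    refine hx.trans ?_
    have h1 : ‖x ^ η‖ ≤ 1 := by
      rw [Real.norm_of_nonneg (by positivity)]
      exact Real.rpow_le_one_of_one_le_of_nonpos hx1 hneg
    calc C * ‖x ^ η‖ ≤ |C| * ‖x ^ η‖ := by gcongr; exact le_abs_self C
      _ ≤ |C| * 1 := by gcongr
      _ = |C| := mul_one _
  obtain ⟨X, hX⟩ := eventually_atTop.1 hb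
  have hlog : Tendsto (fun n : ℕ => Real.log (n : ℝ)) atTop atTop :=
    Real.tendsto_log_atTop.comp tendsto_natCast_atTop_atTop
  obtain ⟨n, hn1, hn2, hn3⟩ := ((eventually_ge_atTop 1).and
    ((tendsto_natCast_atTop_atTop.eventually (eventually_ge_atTop X)).and
      (hlog.eventually (eventually_ge_atTop
        (4 * |C| + |2 * Real.eulerMascheroniConstant - 1| + 1))))).exists
  have h1 := hX n hn2
  have h2 := hX (n + 1 / 2) (by linarith)
  have hfl : ⌊(n : ℝ) + 1 / 2⌋₊ = n := by
    rw [Nat.floor_eq_iff (by positivity)]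
    constructor <;> linarith
  rw [Nat.floor_natCast] at h1
  rw [hfl] at h2
  rw [abs_le] at h1 h2
  have hn0 : (1 : ℝ) ≤ n := by exact_mod_cast hn1
  have h3 : Real.log n ≤ Real.log (n + 1 / 2) := Real.log_le_log (by linarith) (by linarith)
  have h4 : divisorMain (n + 1 / 2) - divisorMain n ≥
      1 / 2 * Real.log n - 1 / 2 * |2 * Real.eulerMascheroniConstant - 1| := by
    have h5 := mul_le_mul_of_nonneg_left h3 (show (0 : ℝ) ≤ n + 1 / 2 by linarith)
    have h6 := neg_abs_le (2 * Real.eulerMascheroniConstant - 1)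
    unfold divisorMain
    nlinarith
  linarith [h1.1, h1.2, h2.1, h2.2]

theorem tau_zero : tau 0 = 0 := rfl

theorem sum_tau_eq (x : ℝ) : ∑ n ∈ Finset.Icc 1 ⌊x⌋₊, (tau n : ℝ) =
    ∑ n ∈ Finset.Icc 0 ⌊x⌋₊, (tau n : ℝ) := by
  rw [← Finset.insert_Icc_add_one_left_eq_Icc (Nat.zero_le _), Finset.sum_insert (by simp)]
  simp [tau_zero]

/-- Once the power of `x` in the error term is positive, the asymptotic estimate for large `x` is
a uniform bound for `x ≥ 1`. -/
theorem exists_divisor_error_le {η : ℝ}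
    (hη : (fun x : ℝ => (∑ n ∈ Finset.Icc 1 ⌊x⌋₊, (tau n : ℝ)) - divisorMain x)
      =O[atTop] (fun x : ℝ => x ^ η)) :
    ∃ C : ℝ, 0 ≤ C ∧ ∀ x : ℝ, 1 ≤ x →
      |(∑ n ∈ Finset.Icc 1 ⌊x⌋₊, (tau n : ℝ)) - divisorMain x| ≤ C * x ^ η := by
  have hpos := pos_of_isBigO_divisor hη
  obtain ⟨C, hC⟩ := hη.bound
  obtain ⟨X, hX⟩ := eventually_atTop.1 hC
  have hcont : ContinuousOn divisorMain (Set.Icc 1 X) := by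
    unfold divisorMain
    refine ContinuousOn.add (continuousOn_id.mul (Real.continuousOn_log.mono ?_)) (by fun_prop)
    intro x hx
    exact (show (0 : ℝ) < x by linarith [hx.1]).ne'
  obtain ⟨B, hB⟩ := isCompact_Icc.exists_bound_of_continuousOn hcont
  set T := ∑ n ∈ Finset.Icc 1 ⌊X⌋₊, (tau n : ℝ)
  have hT : 0 ≤ T := Finset.sum_nonneg fun i _ => Nat.cast_nonneg _
  refine ⟨|C| + (T + |B|), by positivity, fun x hx => ?_⟩
  have hxη : 1 ≤ x ^ η := Real.one_le_rpow hx hpos.le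
  rcases le_total X x with h | h
  · have h1 := hX x h
    rw [Real.norm_eq_abs, Real.norm_of_nonneg (by positivity)] at h1
    refine h1.trans ?_
    gcongr
    linarith [le_abs_self C, abs_nonneg B]
  · have h1 := hB x ⟨hx, h⟩
    have h2 : ∑ n ∈ Finset.Icc 1 ⌊x⌋₊, (tau n : ℝ) ≤ T :=
      Finset.sum_le_sum_of_subset_of_nonneg
        (Finset.Icc_subset_Icc_right (Nat.floor_le_floor h)) fun i _ _ => Nat.cast_nonneg _
    have h3 : 0 ≤ ∑ n ∈ Finset.Icc 1 ⌊x⌋₊, (tau n : ℝ) :=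
      Finset.sum_nonneg fun i _ => Nat.cast_nonneg _
    calc |(∑ n ∈ Finset.Icc 1 ⌊x⌋₊, (tau n : ℝ)) - divisorMain x|
        ≤ |∑ n ∈ Finset.Icc 1 ⌊x⌋₊, (tau n : ℝ)| + |divisorMain x| := abs_sub _ _
      _ ≤ T + |B| := by
        rw [abs_of_nonneg h3]
        exact add_le_add h2 (h1.trans (le_abs_self B))
      _ ≤ (|C| + (T + |B|)) * 1 := by linarith [abs_nonneg C]
      _ ≤ _ := by gcongr

theorem sumSqTau_eq (x : ℝ) : sumSqTau x = ∑ n ∈ Finset.Icc 0 ⌊x⌋₊, (n : ℝ) ^ 2 * tau n := by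
  rw [sumSqTau, ← Finset.insert_Icc_add_one_left_eq_Icc (Nat.zero_le _),
    Finset.sum_insert (by simp)]
  simp

theorem sumSqTau_eq_sub_integral {x : ℝ} (hx : 1 ≤ x) :
    sumSqTau x = x ^ 2 * (∑ n ∈ Finset.Icc 1 ⌊x⌋₊, (tau n : ℝ)) -
      ∫ t in (1 : ℝ)..x, 2 * t * ∑ n ∈ Finset.Icc 1 ⌊t⌋₊, (tau n : ℝ) := by
  have hd : deriv (fun t : ℝ => t ^ 2) = fun t => 2 * t := by ext t; simp
  have h1 := sum_mul_eq_sub_integral_mul₀ (fun n => (tau n : ℝ)) (f := fun t : ℝ => t ^ 2)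
    (by simp [tau_zero]) x (fun t _ => by fun_prop)
    (by rw [hd]; exact (by fun_prop : Continuous fun t : ℝ => 2 * t).integrableOn_Icc)
  rw [sumSqTau_eq, h1, hd, intervalIntegral.integral_of_le hx]
  simp only [sum_tau_eq]

/-- An antiderivative of `2 t · divisorMain t`. -/
noncomputable def divisorMainPrimitive (t : ℝ) : ℝ :=
  2 / 3 * t ^ 3 * Real.log t - 2 / 9 * t ^ 3 +
    2 / 3 * (2 * Real.eulerMascheroniConstant - 1) * t ^ 3

theorem continuousOn_mul_divisorMain {x : ℝ} (hx : 1 ≤ x) :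
    ContinuousOn (fun t => 2 * t * divisorMain t) (Set.uIcc 1 x) := by
  unfold divisorMain
  rw [Set.uIcc_of_le hx]
  refine ContinuousOn.mul (by fun_prop) (ContinuousOn.add
    (continuousOn_id.mul (Real.continuousOn_log.mono ?_)) (by fun_prop))
  intro x hx
  exact (show (0 : ℝ) < x by linarith [hx.1]).ne'

theorem integral_mul_divisorMain {x : ℝ} (hx : 1 ≤ x) :
    ∫ t in (1 : ℝ)..x, 2 * t * divisorMain t =
      divisorMainPrimitive x - divisorMainPrimitive 1 := by
  refine intervalIntegral.integral_eq_sub_of_hasDerivAt (fun t ht => ?_)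
    (continuousOn_mul_divisorMain hx).intervalIntegrable
  rw [Set.uIcc_of_le hx] at ht
  have ht0 : t ≠ 0 := (show (0 : ℝ) < t by linarith [ht.1]).ne'
  have h3 : HasDerivAt (fun t : ℝ => t ^ 3) (3 * t ^ 2) t := by simpa using hasDerivAt_pow 3 t
  have h := (((h3.const_mul (2 / 3)).mul (Real.hasDerivAt_log ht0)).sub
    (h3.const_mul (2 / 9))).add
      (h3.const_mul (2 / 3 * (2 * Real.eulerMascheroniConstant - 1)))
  convert! h using 1
  unfold divisorMain
  field_simp
  ring

/-- The error term of the divisor problem carries over to `∑ n² τ(n)` by partial summation. -/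
theorem exists_sumSqTau_error_le {η : ℝ}
    (hη : (fun x : ℝ => (∑ n ∈ Finset.Icc 1 ⌊x⌋₊, (tau n : ℝ)) - divisorMain x)
      =O[atTop] (fun x : ℝ => x ^ η)) :
    ∃ C : ℝ, 0 ≤ C ∧ ∀ x : ℝ, 1 ≤ x → |sumSqTau x - sqTauMain x| ≤ C * x ^ (2 + η) := by
  have hpos := pos_of_isBigO_divisor hη
  obtain ⟨C, hC0, hC⟩ := exists_divisor_error_le hη
  refine ⟨C + 2 * C + |divisorMainPrimitive 1|, by positivity, fun x hx => ?_⟩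
  have hx0 : 0 < x := by linarith
  set Δ : ℝ → ℝ := fun t => (∑ n ∈ Finset.Icc 1 ⌊t⌋₊, (tau n : ℝ)) - divisorMain t with hΔ
  have hint : IntervalIntegrable (fun t => 2 * t * ∑ n ∈ Finset.Icc 1 ⌊t⌋₊, (tau n : ℝ))
      volume 1 x := by
    rw [intervalIntegrable_iff_integrableOn_Icc_of_le hx]
    exact integrableOn_mul_sum_Icc _ zero_le_one
      (by fun_prop : Continuous fun t : ℝ => 2 * t).integrableOn_Icc
  have hsplit : ∫ t in (1 : ℝ)..x, 2 * t * ∑ n ∈ Finset.Icc 1 ⌊t⌋₊, (tau n : ℝ) =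
      (divisorMainPrimitive x - divisorMainPrimitive 1) + ∫ t in (1 : ℝ)..x, 2 * t * Δ t := by
    have h1 : ∫ t in (1 : ℝ)..x, 2 * t * Δ t =
        (∫ t in (1 : ℝ)..x, 2 * t * ∑ n ∈ Finset.Icc 1 ⌊t⌋₊, (tau n : ℝ)) -
          ∫ t in (1 : ℝ)..x, 2 * t * divisorMain t := by
      rw [← intervalIntegral.integral_sub hint
        (continuousOn_mul_divisorMain hx).intervalIntegrable]
      refine intervalIntegral.integral_congr fun t _ => ?_
      simp only [hΔ]; ring
    rw [h1, integral_mul_divisorMain hx]; ring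
  have hbound : |∫ t in (1 : ℝ)..x, 2 * t * Δ t| ≤ 2 * C * x ^ (2 + η) := by
    have h1 : ‖∫ t in (1 : ℝ)..x, 2 * t * Δ t‖ ≤ (2 * x * (C * x ^ η)) * |x - 1| := by
      refine intervalIntegral.norm_integral_le_of_norm_le_const fun t ht => ?_
      rw [Set.uIoc_of_le hx] at ht
      have ht0 : 0 < t := by linarith [ht.1]
      rw [norm_mul, Real.norm_of_nonneg (show 0 ≤ 2 * t by linarith), Real.norm_eq_abs]
      have h2 := hC t ht.1.le
      have h3 : t ^ η ≤ x ^ η := Real.rpow_le_rpow ht0.le ht.2 hpos.le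
      calc 2 * t * |Δ t| ≤ 2 * x * (C * t ^ η) := by
            gcongr
            exact ht.2
        _ ≤ 2 * x * (C * x ^ η) := by gcongr
    rw [Real.norm_eq_abs, abs_of_nonneg (show 0 ≤ x - 1 by linarith)] at h1
    refine h1.trans ?_
    have h2 : x ^ (2 + η) = x * x * x ^ η := by
      rw [Real.rpow_add hx0, Real.rpow_two, sq]
    rw [h2]
    calc 2 * x * (C * x ^ η) * (x - 1) ≤ 2 * x * (C * x ^ η) * x := by gcongr; linarith
      _ = _ := by ring
  have hone : 1 ≤ x ^ (2 + η) := Real.one_le_rpow hx (by linarith)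
  have hfirst : |x ^ 2 * Δ x| ≤ C * x ^ (2 + η) := by
    rw [abs_mul, abs_of_nonneg (sq_nonneg x), Real.rpow_add hx0, Real.rpow_two]
    calc x ^ 2 * |Δ x| ≤ x ^ 2 * (C * x ^ η) := by gcongr; exact hC x hx
      _ = _ := by ring
  have key : sumSqTau x - sqTauMain x =
      x ^ 2 * Δ x - (∫ t in (1 : ℝ)..x, 2 * t * Δ t) + divisorMainPrimitive 1 := by
    rw [sumSqTau_eq_sub_integral hx, hsplit]
    have hΔx : Δ x = (∑ n ∈ Finset.Icc 1 ⌊x⌋₊, (tau n : ℝ)) - divisorMain x := rfl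
    have hP : divisorMainPrimitive x = 2 / 3 * x ^ 3 * Real.log x - 2 / 9 * x ^ 3 +
      2 / 3 * (2 * Real.eulerMascheroniConstant - 1) * x ^ 3 := rfl
    rw [hΔx, hP, sqTauMain, divisorMain]
    ring
  rw [key]
  calc _ ≤ |x ^ 2 * Δ x| + |∫ t in (1 : ℝ)..x, 2 * t * Δ t| + |divisorMainPrimitive 1| :=
        (abs_add_le _ _).trans (add_le_add_left (abs_sub _ _) _)
    _ ≤ C * x ^ (2 + η) + 2 * C * x ^ (2 + η) + |divisorMainPrimitive 1| * x ^ (2 + η) := by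
        gcongr
        exact le_mul_of_one_le_right (abs_nonneg _) hone
    _ = _ := by ring

theorem abs_sqTauMain_le {x : ℝ} (h0 : 0 < x) (h1 : x ≤ 1) {κ : ℝ} (hκ : κ ≤ 1 / 2) :
    |sqTauMain x| ≤
      (2 + |2 * Real.eulerMascheroniConstant - 1 / 3|) * x ^ (2 + κ) := by
  have hlog : |Real.log x * x ^ (1 / 2 : ℝ)| ≤ 2 := by
    have := Real.abs_log_mul_self_rpow_lt x (1 / 2) h0 h1 (by norm_num)
    norm_num at this ⊢
    exact this.le
  have h52 : x ^ 3 = x ^ (5 / 2 : ℝ) * x ^ (1 / 2 : ℝ) := by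
    rw [← Real.rpow_add h0, ← Real.rpow_natCast]; norm_num
  have h12 : x ^ (1 / 2 : ℝ) ≤ 1 := Real.rpow_le_one h0.le h1 (by norm_num)
  have hle : x ^ (5 / 2 : ℝ) ≤ x ^ (2 + κ) :=
    Real.rpow_le_rpow_of_exponent_ge h0 h1 (by linarith)
  set c := 2 * Real.eulerMascheroniConstant - 1 / 3
  have e : sqTauMain x = x ^ (5 / 2 : ℝ) / 3 *
      (Real.log x * x ^ (1 / 2 : ℝ) + c * x ^ (1 / 2 : ℝ)) := by
    rw [sqTauMain, h52]; ring
  have h3 : |Real.log x * x ^ (1 / 2 : ℝ) + c * x ^ (1 / 2 : ℝ)| ≤ 2 + |c| := by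
    refine (abs_add_le _ _).trans (add_le_add hlog ?_)
    rw [abs_mul, abs_of_nonneg (by positivity : 0 ≤ x ^ (1 / 2 : ℝ))]
    exact mul_le_of_le_one_right (abs_nonneg _) h12
  rw [e, abs_mul, abs_of_nonneg (by positivity : 0 ≤ x ^ (5 / 2 : ℝ) / 3)]
  have h4 : x ^ (5 / 2 : ℝ) / 3 ≤ x ^ (2 + κ) := by
    have : 0 ≤ x ^ (5 / 2 : ℝ) := by positivity
    linarith
  calc _ ≤ x ^ (2 + κ) * (2 + |c|) := by gcongr
    _ = _ := mul_comm _ _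

/-- A bound for the error at every `x ≥ 0`. For `0 < x < 1` the sum is empty and the main term
itself is the error, so that a second, smaller, exponent is needed there. -/
theorem exists_sumSqTau_error_le_of_nonneg {η κ : ℝ} (hκ : κ ≤ 1 / 2)
    (hη : (fun x : ℝ => (∑ n ∈ Finset.Icc 1 ⌊x⌋₊, (tau n : ℝ)) - divisorMain x)
      =O[atTop] (fun x : ℝ => x ^ η)) :
    ∃ C : ℝ, 0 ≤ C ∧ ∀ x : ℝ, 0 ≤ x →
      |sumSqTau x - sqTauMain x| ≤ C * (x ^ (2 + κ) + x ^ (2 + η)) := by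
  obtain ⟨C, hC0, hC⟩ := exists_sumSqTau_error_le hη
  set c := 2 + |2 * Real.eulerMascheroniConstant - 1 / 3|
  have hc : 0 ≤ c := by positivity
  refine ⟨C + c, by positivity, fun x hx => ?_⟩
  have hp1 : 0 ≤ x ^ (2 + κ) := by positivity
  have hp2 : 0 ≤ x ^ (2 + η) := by positivity
  rcases le_or_gt 1 x with h1 | h1
  · refine (hC x h1).trans ?_
    nlinarith [mul_nonneg hC0 hp1, mul_nonneg hc hp1, mul_nonneg hc hp2]
  · have h2 : sumSqTau x = 0 := by
      rw [sumSqTau, Nat.floor_eq_zero.2 h1]; simp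
    rw [h2, zero_sub, abs_neg]
    rcases hx.eq_or_lt with rfl | hx0
    · rw [sqTauMain]
      simp only [ne_eq, OfNat.ofNat_ne_zero, not_false_eq_true, zero_pow, zero_div, zero_mul,
        abs_zero]
      positivity
    · refine (abs_sqTauMain_le hx0 h1.le hκ).trans ?_
      nlinarith [mul_nonneg hC0 hp1, mul_nonneg hC0 hp2, mul_nonneg hc hp2]

end RankThree

/-! ### The summatory function of `s` -/

namespace RankThree

open Filter Asymptotics

/-- The summatory function of the convolution `s = h ∗ n² τ(n)`. -/
theorem sum_s_eq (x : ℝ) : (∑ n ∈ Finset.Icc 1 ⌊x⌋₊, (s n : ℝ)) =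
    ∑ m ∈ Finset.Icc 1 ⌊x⌋₊, (h m : ℝ) * sumSqTau (x / m) := by
  have hIcc : ∀ N : ℕ, Finset.Ioc 0 N = Finset.Icc 1 N := fun N => rfl
  have h1 := ArithmeticFunction.sum_Ioc_mul_eq_sum_sum hFun (sqFun * sqFun) ⌊x⌋₊
  rw [← sFun_eq_hFun_mul] at h1
  simp only [hIcc, sqFun_mul_sqFun] at h1
  have h2 := congrArg (Int.cast : ℤ → ℝ) h1
  push_cast at h2
  calc _ = ∑ n ∈ Finset.Icc 1 ⌊x⌋₊, ((sFun n : ℤ) : ℝ) := by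
        refine Finset.sum_congr rfl fun n hn => ?_
        have : n ≠ 0 := by
          have := (Finset.mem_Icc.1 hn).1
          omega
        simp [sFun, this]
    _ = _ := h2
    _ = _ := by
        refine Finset.sum_congr rfl fun m hm => ?_
        rw [h_eq_hFun (Finset.mem_Icc.1 hm).1, sumSqTau, Nat.floor_div_natCast]

/-- The sum over `m ≤ x` may run over all `m`: `sumSqTau (x / m)` vanishes for `m > x`, and also for
`m = 0`, where `x / 0 = 0`. -/
theorem hasSum_h_mul_sumSqTau (x : ℝ) :
    HasSum (fun m : ℕ => (h m : ℂ) * (sumSqTau (x / m) : ℂ))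
      (∑ n ∈ Finset.Icc 1 ⌊x⌋₊, (s n : ℂ)) := by
  have h1 : (∑ n ∈ Finset.Icc 1 ⌊x⌋₊, (s n : ℂ)) =
      ∑ m ∈ Finset.Icc 1 ⌊x⌋₊, (h m : ℂ) * (sumSqTau (x / m) : ℂ) := by
    exact_mod_cast congrArg (Complex.ofReal) (sum_s_eq x)
  rw [h1]
  refine hasSum_sum_of_ne_finset_zero fun m hm => ?_
  have h2 : sumSqTau (x / m) = 0 := by
    rw [sumSqTau, Nat.floor_div_natCast]
    have : ⌊x⌋₊ / m = 0 := by
      rw [Nat.div_eq_zero_iff]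
      rw [Finset.mem_Icc] at hm
      omega
    rw [this]; simp
  rw [h2]; simp

/-- The main terms add up to the values of `H` and `H'` at `3`. -/
theorem hasSum_h_mul_sqTauMain {x : ℝ} (hx : 0 < x) :
    HasSum (fun m : ℕ => (h m : ℂ) * (sqTauMain (x / m) : ℂ))
      ((x : ℂ) ^ 3 / 3 *
        (H 3 * ((Real.log x : ℂ) + 2 * (Real.eulerMascheroniConstant : ℂ) - 1 / 3)
          + deriv H 3)) := by
  have habs : LSeries.abscissaOfAbsConv (fun n => (h n : ℂ)) < (3 : ℂ).re := by
    refine abscissaOfAbsConv_h_lt.trans_eq ?_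
    rw [Complex.re_ofNat]
    rfl
  have h1 : HasSum (LSeries.term (fun n => (h n : ℂ)) 3) (H 3) :=
    (LSeriesSummable_of_abscissaOfAbsConv_lt_re habs).hasSum
  have h2 : HasSum (LSeries.term (LSeries.logMul fun n => (h n : ℂ)) 3) (-deriv H 3) := by
    have : deriv H 3 = -LSeries (LSeries.logMul fun n => (h n : ℂ)) 3 := LSeries_deriv habs
    rw [this, neg_neg]
    exact (LSeriesSummable_logMul_of_lt_re habs).hasSum
  have h3 := ((h1.mul_right
    ((Real.log x : ℂ) + 2 * (Real.eulerMascheroniConstant : ℂ) - 1 / 3)).sub h2).mul_left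
      ((x : ℂ) ^ 3 / 3)
  rw [sub_neg_eq_add] at h3
  convert! h3 using 1
  ext m
  rcases eq_or_ne m 0 with rfl | hm
  -- Both sides vanish at `m = 0`, since `x / 0 = 0`.
  · simp [sqTauMain]
  · have hm0 : (m : ℝ) ≠ 0 := by exact_mod_cast hm
    have hmc : (m : ℂ) ≠ 0 := by exact_mod_cast hm
    have hpow : (m : ℂ) ^ (3 : ℂ) = (m : ℂ) ^ 3 := by
      exact_mod_cast Complex.cpow_natCast (m : ℂ) 3
    rw [LSeries.term_of_ne_zero hm, LSeries.term_of_ne_zero hm, LSeries.logMul, hpow, sqTauMain,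
      Real.log_div hx.ne' hm0, ← Complex.natCast_log]
    push_cast
    field_simp
    ring

theorem abs_h_mul_div_rpow (m : ℕ) {x : ℝ} (hx : 0 ≤ x) (σ : ℝ) :
    |(h m : ℝ)| * (x / m) ^ σ = x ^ σ * (|(h m : ℝ)| * (m : ℝ) ^ (-σ)) := by
  rw [Real.div_rpow hx (Nat.cast_nonneg m), Real.rpow_neg (Nat.cast_nonneg m)]
  ring

/-- An error term with exponent `η` in the divisor problem yields one with exponent `2 + η` for the
sum of `s`, since the Dirichlet series of `|h|` converges at `2 + η`. -/
theorem sum_s_isBigO {η : ℝ}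
    (hη : (fun x : ℝ => (∑ n ∈ Finset.Icc 1 ⌊x⌋₊, (tau n : ℝ)) - divisorMain x)
      =O[atTop] (fun x : ℝ => x ^ η)) :
    (fun x : ℝ => (∑ n ∈ Finset.Icc 1 ⌊x⌋₊, (s n : ℂ)) - (x : ℂ) ^ 3 / 3 *
        (H 3 * ((Real.log x : ℂ) + 2 * (Real.eulerMascheroniConstant : ℂ) - 1 / 3)
          + deriv H 3)) =O[atTop] (fun x : ℝ => x ^ (2 + η)) := by
  have hpos := pos_of_isBigO_divisor hη
  -- For `m > x` the error at `x / m < 1` needs an exponent below `3`, hence the cap on `η`.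
  set κ := min η (1 / 2)
  have hκ0 : 0 < κ := lt_min hpos (by norm_num)
  obtain ⟨C, hC0, hC⟩ := exists_sumSqTau_error_le_of_nonneg (κ := κ) (min_le_right _ _) hη
  have hs1 := summable_abs_h_mul_rpow (σ := 2 + κ) (by linarith)
  have hs2 := summable_abs_h_mul_rpow (σ := 2 + η) (by linarith)
  set S1 := ∑' m : ℕ, |(h m : ℝ)| * (m : ℝ) ^ (-(2 + κ))
  set S2 := ∑' m : ℕ, |(h m : ℝ)| * (m : ℝ) ^ (-(2 + η))
  have hS1 : 0 ≤ S1 := tsum_nonneg fun m => by positivity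
  have hS2 : 0 ≤ S2 := tsum_nonneg fun m => by positivity
  refine IsBigO.of_bound (C * (S1 + S2)) ?_
  filter_upwards [eventually_ge_atTop 1] with x hx
  have hx0 : 0 < x := by linarith
  have h1 := (hasSum_h_mul_sumSqTau x).sub (hasSum_h_mul_sqTauMain hx0)
  have h2 : HasSum (fun m : ℕ => C * (x ^ (2 + κ) * (|(h m : ℝ)| * (m : ℝ) ^ (-(2 + κ))) +
      x ^ (2 + η) * (|(h m : ℝ)| * (m : ℝ) ^ (-(2 + η)))))
      (C * (x ^ (2 + κ) * S1 + x ^ (2 + η) * S2)) :=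
    ((hs1.hasSum.mul_left _).add (hs2.hasSum.mul_left _)).mul_left C
  rw [← h1.tsum_eq, Real.norm_of_nonneg (by positivity)]
  refine (tsum_of_norm_bounded h2 fun m => ?_).trans ?_
  · rw [← mul_sub, norm_mul, Complex.norm_intCast, ← Complex.ofReal_sub, Complex.norm_real,
      Real.norm_eq_abs, ← abs_h_mul_div_rpow m hx0.le, ← abs_h_mul_div_rpow m hx0.le]
    calc |(h m : ℝ)| * |sumSqTau (x / m) - sqTauMain (x / m)|
        ≤ |(h m : ℝ)| * (C * ((x / m) ^ (2 + κ) + (x / m) ^ (2 + η))) := by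
          gcongr
          exact hC _ (by positivity)
      _ = _ := by ring
  · have h3 : x ^ (2 + κ) ≤ x ^ (2 + η) :=
      Real.rpow_le_rpow_of_exponent_le hx (by linarith [min_le_left η (1 / 2)])
    calc _ ≤ C * (x ^ (2 + η) * S1 + x ^ (2 + η) * S2) := by gcongr
      _ = _ := by ring

end RankThree

theorem theorem3 (θ : ℝ)
    (hθ : ∀ ε : ℝ, 0 < ε →
      (fun x : ℝ => (∑ n ∈ Finset.Icc 1 ⌊x⌋₊, (RankThree.tau n : ℝ))
          - (x * Real.log x + (2 * Real.eulerMascheroniConstant - 1) * x))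
        =O[Filter.atTop] (fun x : ℝ => x ^ (θ + ε))) :
    LSeries.abscissaOfAbsConv (fun n => (RankThree.h n : ℂ)) < 3 ∧
    ∀ ε : ℝ, 0 < ε →
      (fun x : ℝ => (∑ n ∈ Finset.Icc 1 ⌊x⌋₊, (RankThree.s n : ℂ))
          - (x : ℂ) ^ 3 / 3 *
            (RankThree.H 3 *
                ((Real.log x : ℂ) + 2 * (Real.eulerMascheroniConstant : ℂ) - 1 / 3)
              + deriv RankThree.H 3))
        =O[Filter.atTop] (fun x : ℝ => x ^ (2 + θ + ε)) := by
  refine ⟨RankThree.abscissaOfAbsConv_h_lt, fun ε hε => ?_⟩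
  rw [show 2 + θ + ε = 2 + (θ + ε) by ring]
  exact RankThree.sum_s_isBigO (hθ ε hε)
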